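/- **Setting.** Let $n,m,T$ be natural numbers (state dimension, input dimension, horizon), and let $|\cdot|$ denote Euclidean norms. Consider a controlled system on $\mathbb R^n$ with fixed initial state $x(0)=x_0$ and dynamics $$x(t+1)=f(t,x(t),u(t),\zeta(t)),\qquad t=0,\dots,T-1,$$ where $u(t)\in U_t\subseteq\mathbb R^m$ and, given the past, the noise $\zeta(t)\in\mathbb R^n$ has distribution $\mathcal D(x(t),u(t))$. Let $\hat f(t,x,a)$ be a known function (an estimate of $f(t,x,a,\zeta)$). For each fixed input $a$, $f(t,\cdot,a,\cdot)$ and $\hat f(t,\cdot,a)$ are measurable and $\mathcal D(\cdot,a)$ is a Markov kernel. Put $w(t):=f(t,x(t),u(t),\zeta(t))-\hat f(t,x(t),u(t))$; its distribution is determined by the open-loop control $\mathbf u=(u(0),\dots,u(T-1))$. Let $U:=U_0\times\dots\times U_{T-1}\subseteq\mathbb R^{mT}$ be non-empty. For $\mathbf w\in\mathbb R^{nT}$ and $\mathbf u\in\mathbb R^{mT}$ let $\mathbf x(\mathbf u,\mathbf w)$ be the trajectory with $x(0)=x_0$ and $x(t+1)=\hat f(t,x(t),u(t))+w(t)$, and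 for given real-valued costs $\phi,\varphi$ let $$L(\mathbf w,\mathbf u):=\phi(x(T))+\sum_{t=0}^{T-1}\varphi(x(t),u(t)),\qquad \mathbf x=\mathbf x(\mathbf u,\mathbf w).$$ Fix a probability level $p\in(0,1)$. For $\mathbf u\in U$ define the quantiles and confidence sets $$Q_t(\mathbf u):=\inf\{r:\mathbb P(|w(t)|\le r)\ge 1-p/T\},\qquad C(\mathbf u):=\prod_{t=0}^{T-1}\{w\in\mathbb R^n:|w|\le Q_t(\mathbf u)\},$$ and for $\mathbf u,\mathbf v\in U$ let $g(\mathbf u,\mathbf v):=\max\{L(\mathbf w,\mathbf v):\mathbf w\in C(\mathbf u)\}$, where this maximum is assumed to be attained. An *ideal refinement map* is a map $\mathcal A:U\to U$ with $\mathcal A(\mathbf u)\in\operatorname{argmin}\{g(\mathbf u,\mathbf v):\mathbf v\in U\}$ for every $\mathbf u\in U$. A *performatively stable control* is a $\mathbf u_{PS}\in U$ with $\mathcal A(\mathbf u_{PS})=\mathbf u_{PS}$. **Theorem (existence of performatively stable control).** Suppose that - for every $\mathbf w\in\mathbb R^{nT}$, $L(\mathbf w,\mathbf u)$ is strictly convex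 in $\mathbf u\in U$; - $g(\mathbf u,\mathbf v)$ is jointly continuous in $(\mathbf u,\mathbf v)\in U\times U$; - for each $t=0,\dots,T-1$ the quantile function $Q_t$ is $\epsilon_t$-Lipschitz on $U$, i.e. $|Q_t(\mathbf u)-Q_t(\mathbf u')|\le\epsilon_t|\mathbf u-\mathbf u'|$ for all $\mathbf u,\mathbf u'\in U$; - $U$ is compact and convex. Then an ideal refinement map $\mathcal A$ exists, and every ideal refinement map has a fixed point; that is, there exists at least one performatively stable control. -/

import Mathlib

open MeasureTheory ProbabilityTheory
open scoped NNReal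

/-- `ℝᵏ` with its Euclidean norm. -/
abbrev Euc (k : ℕ) : Type := EuclideanSpace ℝ (Fin k)

/-- Trajectories `(y(0), …, y(T-1))` of vectors of `ℝᵏ`, i.e. `ℝ^{kT}` with its Euclidean norm. -/
abbrev Traj (k T : ℕ) : Type := PiLp 2 (fun _ : Fin T => Euc k)

/-- The data of the control problem with decision-dependent noise: state space `ℝⁿ`, input space
`ℝᵐ`, horizon `T`. -/
structure NoisySystem (n m T : ℕ) where
  /-- the underlying dynamics `x(t+1) = f(t, x(t), u(t), ζ(t))` -/
  f : Fin T → Euc n → Euc m → Euc n → Euc n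
  measurable_f : ∀ t a, Measurable (fun z : Euc n × Euc n => f t z.1 a z.2)
  /-- the known estimate of `f(t, x(t), u(t), ζ(t))` -/
  fhat : Fin T → Euc n → Euc m → Euc n
  measurable_fhat : ∀ t a, Measurable (fun x : Euc n => fhat t x a)
  /-- `D a x` is the distribution of `ζ(t)` when `u(t) = a` and `x(t) = x` -/
  D : Euc m → Kernel (Euc n) (Euc n)
  markov_D : ∀ a, IsMarkovKernel (D a)
  /-- the fixed initial state -/
  x₀ : Euc n
  /-- the terminal cost `φ(x(T))` -/
  terminalCost : Euc n → ℝ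
  /-- the running cost `ϕ(x(t), u(t))` -/
  runningCost : Euc n → Euc m → ℝ
  /-- the admissible inputs `U_t` -/
  inputs : Fin T → Set (Euc m)

namespace NoisySystem

variable {n m T : ℕ} (S : NoisySystem n m T)

/-- The set `U = U_0 × ⋯ × U_{T-1}` of feasible open-loop controls. -/
def controls : Set (Traj m T) := {u | ∀ t, u t ∈ S.inputs t}

/-- The state trajectory `x(u, w)`: `x(0) = x₀`, `x(t+1) = f̂(t, x(t), u(t)) + w(t)`. -/
def state (w : Traj n T) (u : Traj m T) : Fin (T + 1) → Euc n :=
  Fin.induction S.x₀ (fun t x => S.fhat t x (u t) + w t)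

/-- The loss `J(x, u) = φ(x(T)) + ∑ₜ ϕ(x(t), u(t))` of a trajectory. -/
noncomputable def trajectoryLoss (x : Fin (T + 1) → Euc n) (u : Traj m T) : ℝ :=
  S.terminalCost (x (Fin.last T)) + ∑ t : Fin T, S.runningCost (x t.castSucc) (u t)

/-- The loss `L(w, u) = J(x(u, w), u)`. -/
noncomputable def loss (w : Traj n T) (u : Traj m T) : ℝ :=
  S.trajectoryLoss (S.state w u) u

/-- The law of the random state `x(t)` under the control `u`: `x(0) = x₀`, and
`x(t+1) = f(t, x(t), u(t), ζ(t))` where, given the past, `ζ(t)` has law `D(x(t), u(t))`. -/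
noncomputable def stateLaw (u : Traj m T) : Fin (T + 1) → Measure (Euc n) :=
  Fin.induction (Measure.dirac S.x₀)
    (fun t μ => (μ ⊗ₘ S.D (u t)).map (fun z => S.f t z.1 (u t) z.2))

/-- The law of the noise `w(t) = f(t, x(t), u(t), ζ(t)) - f̂(t, x(t), u(t))` under `u`. -/
noncomputable def noiseLaw (u : Traj m T) (t : Fin T) : Measure (Euc n) :=
  (S.stateLaw u t.castSucc ⊗ₘ S.D (u t)).map
    (fun z => S.f t z.1 (u t) z.2 - S.fhat t z.1 (u t))

/-- `Q_t(u) = inf {r : ℙ(|w(t)| ≤ r) ≥ 1 - p/T}`. -/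
noncomputable def quantile (p : ℝ) (t : Fin T) (u : Traj m T) : ℝ :=
  sInf {r : ℝ | 1 - p / (T : ℝ) ≤ (S.noiseLaw u t).real {w | ‖w‖ ≤ r}}

/-- The ideal confidence set `C(u) = C_0(u) × ⋯ × C_{T-1}(u)`, `C_t(u) = {w : |w| ≤ Q_t(u)}`. -/
def confidenceSet (p : ℝ) (u : Traj m T) : Set (Traj n T) :=
  {w | ∀ t, ‖w t‖ ≤ S.quantile p t u}

/-- `g(u, v) = max {L(w, v) : w ∈ C(u)}`, as a supremum. -/
noncomputable def worstCaseLoss (p : ℝ) (u v : Traj m T) : ℝ :=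
  sSup ((fun w => S.loss w v) '' S.confidenceSet p u)

/-- `A : U → U` is an ideal refinement map: `A(u) ∈ argmin {g(u, v) : v ∈ U}`. -/
def IsIdealRefinement (p : ℝ) (A : S.controls → S.controls) : Prop :=
  ∀ u : S.controls, IsMinOn (fun v => S.worstCaseLoss p u v) S.controls (A u)

/-- `u ∈ U` is performatively stable (with respect to the refinement map `A`): `A(u) = u`. -/
def IsPerformativelyStable (A : S.controls → S.controls) (u : S.controls) : Prop :=
  A u = u

end NoisySystem

/-! Each `g(u, ·)` is a maximum of strictly convex functions, and since the maximum is attained it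
is itself strictly convex (`strictConvexOn_sSup_image`). On the compact convex set `U` its minimizer
therefore exists and is unique, and joint continuity makes the minimizer continuous in `u`
(`continuous_argmin_of_unique`). Brouwer's theorem then gives a fixed point.

Brouwer's theorem rests on `not_exists_contDiffAt_retraction`, proved by a volume argument. For a
retraction `r` and small `t > 0`, `x + t (r x - x)` maps the ball bijectively to itself, so its
Jacobian integrates to the volume of the ball. The Jacobian is polynomial in `t`, so this persists
at `t = 1`, where it is `det r'`, which vanishes because `‖r‖` is constant. -/

/-! ### Determinants of perturbations of the identity -/

section Determinant

variable {E : Type*} [NormedAddCommGroup E] [NormedSpace ℝ E] [FiniteDimensional ℝ E]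

/-- Lagrange interpolation of the polynomial `t ↦ det (1 + t A)` at small positive nodes. -/
theorem ContinuousLinearMap.exists_det_one_add_eq_sum (E : Type*) [NormedAddCommGroup E]
    [NormedSpace ℝ E] [FiniteDimensional ℝ E] {τ : ℝ} (hτ : 0 < τ) :
    ∃ (N : ℕ) (t c : ℕ → ℝ), (∀ i, 0 < t i ∧ t i < τ) ∧
      ∀ A : E →L[ℝ] E, (1 + A).det = ∑ i ∈ Finset.range N, c i * (1 + t i • A).det := by
  classical
  set d := Module.finrank ℝ E
  -- The shift by 2 keeps even the node `i = 0` strictly below `τ`.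
  let t : ℕ → ℝ := fun i => τ / (i + 2)
  have ht : Function.Injective t := by
    intro i j hij
    have hi : (0 : ℝ) < i + 2 := by positivity
    have hj : (0 : ℝ) < j + 2 := by positivity
    have h : τ / ((i : ℝ) + 2) = τ / (j + 2) := hij
    rw [div_eq_div_iff hi.ne' hj.ne'] at h
    have := mul_left_cancel₀ hτ.ne' h
    exact_mod_cast (show (i : ℝ) = j by linarith)
  refine ⟨d + 1, t, fun i => (Lagrange.basis (Finset.range (d + 1)) t i).eval 1, fun i => ?_,
    fun A => ?_⟩
  · have hi : (1 : ℝ) < (i : ℝ) + 2 := by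
      have : (0 : ℝ) ≤ i := i.cast_nonneg
      linarith
    exact ⟨div_pos hτ (by linarith), div_lt_self hτ hi⟩
  · let b := Module.finBasis ℝ E
    let M := LinearMap.toMatrix b b (A : E →ₗ[ℝ] E)
    let P : Polynomial ℝ := Matrix.det
      ((Polynomial.X : Polynomial ℝ) • M.map Polynomial.C + (1 : Matrix _ _ ℝ).map Polynomial.C)
    have hP : ∀ s : ℝ, P.eval s = (1 + s • A).det := by
      intro s
      have h1 : P.eval s = Matrix.det (1 + s • M) := by
        change Polynomial.evalRingHom s P = _
        rw [RingHom.map_det]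
        congr 1
        ext i j
        rcases eq_or_ne i j with rfl | hij
        · simp; ring
        · simp [hij]; ring
      rw [h1, ContinuousLinearMap.det, ← LinearMap.det_toMatrix b]
      congr 1
      have : ((1 + s • A : E →L[ℝ] E) : E →ₗ[ℝ] E) = 1 + s • (A : E →ₗ[ℝ] E) := rfl
      rw [this, map_add, map_smul, LinearMap.toMatrix_one]
    have hdeg : P.degree < (Finset.range (d + 1)).card := by
      refine lt_of_le_of_lt Polynomial.degree_le_natDegree ?_
      rw [Finset.card_range]
      have := Polynomial.natDegree_det_X_add_C_le M 1
      rw [Fintype.card_fin] at this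
      exact_mod_cast Nat.lt_succ_of_le this
    have h := congrArg (Polynomial.eval 1)
      (Lagrange.eq_interpolate (v := t) ht.injOn hdeg)
    rw [hP, one_smul, Lagrange.interpolate_apply, Polynomial.eval_finsetSum] at h
    rw [h]
    refine Finset.sum_congr rfl fun i _ => ?_
    rw [Polynomial.eval_mul, Polynomial.eval_C, hP, mul_comm]

theorem ContinuousLinearMap.det_one_add_ne_zero {A : E →L[ℝ] E} (hA : ‖A‖ < 1) :
    (1 + A).det ≠ 0 := by
  intro h
  have h' := LinearMap.bot_lt_ker_of_det_eq_zero (f := ((1 + A : E →L[ℝ] E) : E →ₗ[ℝ] E)) h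
  obtain ⟨v, hv, hv0⟩ := Submodule.exists_mem_ne_zero_of_ne_bot h'.ne'
  have hv1 : v + A v = 0 := hv
  have hn : ‖v‖ = ‖A v‖ := by
    rw [← norm_neg (A v), ← eq_neg_of_add_eq_zero_left hv1]
  have := A.le_opNorm v
  have hpos : 0 < ‖v‖ := norm_pos_iff.2 hv0
  nlinarith

/-- Along the segment from `1` to `1 + A` the determinant starts at 1 and never vanishes. -/
theorem ContinuousLinearMap.det_one_add_pos {A : E →L[ℝ] E} (hA : ‖A‖ < 1) :
    0 < (1 + A).det := by
  by_contra! hneg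
  have hc : ContinuousOn (fun s : ℝ => (1 + s • A).det) (Set.Icc 0 1) := by
    refine (ContinuousLinearMap.continuous_det.comp ?_).continuousOn
    fun_prop
  have hmem : (0 : ℝ) ∈ Set.Icc ((1 + (1 : ℝ) • A).det) ((1 + (0 : ℝ) • A).det) := by
    refine ⟨by simpa using hneg, ?_⟩
    rw [zero_smul, add_zero]
    have : (1 : E →L[ℝ] E).det = 1 := by
      change LinearMap.det (1 : E →ₗ[ℝ] E) = 1
      exact map_one _
    rw [this]
    exact zero_le_one
  obtain ⟨s, hs, h0⟩ := intermediate_value_Icc' zero_le_one hc hmem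
  refine ContinuousLinearMap.det_one_add_ne_zero ?_ h0
  rw [norm_smul, Real.norm_of_nonneg hs.1]
  have := norm_nonneg A
  nlinarith [hs.2]

end Determinant

/-! ### Metric projection onto convex sets -/

section Projection

variable {E : Type*} [NormedAddCommGroup E] [InnerProductSpace ℝ E]

/-- The metric projection onto a complete convex set, characterized by its variational
inequality. -/
theorem Convex.exists_projection {K : Set E} (hK : Convex ℝ K) (hne : K.Nonempty)
    (hc : IsComplete K) :
    ∃ P : E → E, LipschitzWith 1 P ∧ ∀ x, P x ∈ K ∧ ∀ y ∈ K, inner ℝ (x - P x) (y - P x) ≤ 0 := by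
  have h : ∀ x, ∃ v ∈ K, ∀ y ∈ K, inner ℝ (x - v) (y - v) ≤ 0 := fun x => by
    obtain ⟨v, hv, hmin⟩ := exists_norm_eq_iInf_of_complete_convex hne hc hK x
    exact ⟨v, hv, (norm_eq_iInf_iff_real_inner_le_zero hK hv).1 hmin⟩
  choose P hP hPi using h
  refine ⟨P, LipschitzWith.of_dist_le_mul fun x y => ?_, fun x => ⟨hP x, hPi x⟩⟩
  rw [NNReal.coe_one, one_mul, dist_eq_norm, dist_eq_norm]
  have h1 := hPi x (P y) (hP y)
  have h2 := hPi y (P x) (hP x)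
  have h3 : ‖P x - P y‖ ^ 2 ≤ inner ℝ (x - y) (P x - P y) := by
    rw [← real_inner_self_eq_norm_sq]
    simp only [inner_sub_left, inner_sub_right] at h1 h2 ⊢
    linarith
  have h4 := real_inner_le_norm (x - y) (P x - P y)
  by_contra! hlt
  have := norm_nonneg (x - y)
  nlinarith

/-- From an interior point `p` a short move towards `x` stays in the ball, so the variational
inequality at `p` forces `x - p = 0`. -/
theorem eq_of_projection_closedBall {R : ℝ} {x p : E} (hp : ‖p‖ < R)
    (h : ∀ y ∈ Metric.closedBall (0 : E) R, inner ℝ (x - p) (y - p) ≤ 0) : x = p := by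
  have hc : Filter.Tendsto (fun s : ℝ => ‖p + s • (x - p)‖) (nhdsWithin 0 (Set.Ioi 0))
      (nhds ‖p + (0 : ℝ) • (x - p)‖) := by
    refine Filter.Tendsto.mono_left (Continuous.tendsto ?_ 0) nhdsWithin_le_nhds
    fun_prop
  rw [zero_smul, add_zero] at hc
  obtain ⟨s, hs, hs0⟩ := ((hc.eventually (gt_mem_nhds hp)).and self_mem_nhdsWithin).exists
  have h1 := h (p + s • (x - p)) (mem_closedBall_zero_iff.2 hs.le)
  rw [add_sub_cancel_left, inner_smul_right, real_inner_self_eq_norm_sq] at h1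
  have h2 : ‖x - p‖ ^ 2 ≤ 0 := by
    have : (0 : ℝ) < s := hs0
    by_contra! h3
    exact absurd h1 (not_le.2 (mul_pos this h3))
  have h3 : ‖x - p‖ = 0 := by nlinarith [norm_nonneg (x - p)]
  exact sub_eq_zero.1 (norm_eq_zero.1 h3)

end Projection

/-! ### No `C¹` retraction onto the sphere -/

section NoRetraction

variable {E : Type*} [NormedAddCommGroup E] [InnerProductSpace ℝ E] [FiniteDimensional ℝ E]

/-- A small Lipschitz perturbation of the identity that moves no boundary point and preserves a
closed ball is a bijection of that ball. -/
theorem bijOn_closedBall_add_smul {R : ℝ} {h : E → E} {K : ℝ≥0} {t : ℝ}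
    (hR : 0 ≤ R) (hlip : LipschitzOnWith K h (Metric.closedBall 0 R))
    (h0 : ∀ x, ‖x‖ = R → h x = 0) (ht0 : 0 ≤ t) (ht : t * K < 1)
    (hmaps : Set.MapsTo (fun x => x + t • h x) (Metric.closedBall 0 R) (Metric.closedBall 0 R)) :
    Set.BijOn (fun x => x + t • h x) (Metric.closedBall 0 R) (Metric.closedBall 0 R) := by
  have := FiniteDimensional.complete ℝ E
  refine ⟨hmaps, fun x hx y hy hxy => ?_, fun y hy => ?_⟩
  · have h1 : x - y = t • (h y - h x) := by
      have hxy' : x + t • h x = y + t • h y := hxy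
      rw [smul_sub, sub_eq_sub_iff_add_eq_add, hxy', add_comm]
    have h2 : ‖x - y‖ ≤ t * (K * ‖x - y‖) := by
      calc ‖x - y‖ = t * ‖h y - h x‖ := by rw [h1, norm_smul, Real.norm_of_nonneg ht0]
        _ ≤ t * (K * ‖y - x‖) := mul_le_mul_of_nonneg_left (hlip.norm_sub_le hy hx) ht0
        _ = _ := by rw [norm_sub_rev]
    have h3 : ‖x - y‖ = 0 := by
      have := norm_nonneg (x - y)
      nlinarith
    exact sub_eq_zero.1 (norm_eq_zero.1 h3)
  · obtain ⟨P, hPl, hP⟩ := (convex_closedBall (0 : E) R).exists_projection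
      ⟨0, Metric.mem_closedBall_self hR⟩ Metric.isClosed_closedBall.isComplete
    -- Precomposing with the projection extends `h` to the whole space, so Banach's theorem applies.
    have hcontr : ContractingWith (Real.toNNReal (t * K)) (fun z => y - t • h (P z)) := by
      refine ⟨by rw [← NNReal.coe_lt_coe, Real.coe_toNNReal _ (by positivity)]; exact_mod_cast ht,
        LipschitzWith.of_dist_le_mul fun z z' => ?_⟩
      rw [Real.coe_toNNReal _ (by positivity), dist_sub_left, dist_eq_norm, ← smul_sub, norm_smul,
        Real.norm_of_nonneg ht0, mul_assoc]
      refine mul_le_mul_of_nonneg_left ?_ ht0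
      refine (hlip.norm_sub_le (hP z).1 (hP z').1).trans ?_
      refine mul_le_mul_of_nonneg_left ?_ K.2
      simpa [dist_eq_norm] using hPl.dist_le_mul z z'
    set x := hcontr.fixedPoint
    have hfix : y - t • h (P x) = x := hcontr.fixedPoint_isFixedPt
    -- If `P x` is on the sphere, then `h (P x) = 0` and `x = y` is already in the ball.
    have hPx : P x = x := by
      rcases (mem_closedBall_zero_iff.1 (hP x).1).lt_or_eq with hlt | heq
      · exact (eq_of_projection_closedBall hlt (hP x).2).symm
      · rw [h0 _ heq, smul_zero, sub_zero] at hfix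
        have h1 := (hP x).2 x (hfix ▸ hy)
        rw [real_inner_self_eq_norm_sq] at h1
        have h2 : ‖x - P x‖ = 0 := by nlinarith [norm_nonneg (x - P x)]
        exact (sub_eq_zero.1 (norm_eq_zero.1 h2)).symm
    rw [hPx] at hfix
    refine ⟨x, hPx ▸ (hP x).1, ?_⟩
    change x + t • h x = y
    rw [← hfix]
    nth_rewrite 2 [hfix]
    abel

/-- There is no `C¹` retraction of a closed ball onto its boundary sphere. -/
theorem not_exists_contDiffAt_retraction {R : ℝ} (hR : 0 < R) {r : E → E}
    (hr : ∀ x ∈ Metric.closedBall (0 : E) R, ContDiffAt ℝ 1 r x)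
    (hnorm : ∀ x ∈ Metric.closedBall (0 : E) R, ‖r x‖ = R)
    (hid : ∀ x, ‖x‖ = R → r x = x) : False := by
  borelize E
  let μ : Measure E := Measure.addHaar
  set B := Metric.closedBall (0 : E) R
  have hBc : IsCompact B := isCompact_closedBall 0 R
  have hBconv : Convex ℝ B := convex_closedBall 0 R
  have hdiff : ∀ x ∈ B, HasFDerivAt r (fderiv ℝ r x) x := fun x hx =>
    ((hr x hx).differentiableAt one_ne_zero).hasFDerivAt
  let D : E → E →L[ℝ] E := fun x => fderiv ℝ r x - 1
  have hDc : ContinuousOn D B := fun x hx =>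
    (((hr x hx).continuousAt_fderiv one_ne_zero).sub continuousAt_const).continuousWithinAt
  have hDd : ∀ x ∈ B, HasFDerivAt (fun y => r y - y) (D x) x := fun x hx =>
    (hdiff x hx).sub (hasFDerivAt_id x)
  obtain ⟨C, hC⟩ := hBc.exists_bound_of_continuousOn hDc
  let K : ℝ≥0 := C.toNNReal
  have hK : ∀ x ∈ B, ‖D x‖ ≤ K := fun x hx => (hC x hx).trans (Real.le_coe_toNNReal C)
  have hlip : LipschitzOnWith K (fun y => r y - y) B :=
    hBconv.lipschitzOnWith_of_nnnorm_hasFDerivWithin_le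
      (fun x hx => (hDd x hx).hasFDerivWithinAt) hK
  -- This bound on the nodes yields both `t i * K < 1` and `t i ≤ 1`.
  have hτ : (0 : ℝ) < 1 / (K + 1) := by positivity
  obtain ⟨N, t, c, ht, hdet⟩ := ContinuousLinearMap.exists_det_one_add_eq_sum E hτ
  have htK : ∀ i, t i * K < 1 := fun i => by
    have h1 := (ht i).2
    rw [lt_div_iff₀ (by positivity)] at h1
    nlinarith [(ht i).1]
  have ht1 : ∀ i, t i ≤ 1 := fun i => by
    refine (ht i).2.le.trans ?_
    rw [div_le_one (by positivity)]
    linarith [show (0 : ℝ) ≤ K from K.2]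
  have hbij : ∀ i, Set.BijOn (fun x => x + t i • (r x - x)) B B := fun i => by
    refine bijOn_closedBall_add_smul hR.le hlip (fun x hx => sub_eq_zero.2 (hid x hx))
      (ht i).1.le (htK i) fun x hx => ?_
    exact hBconv.add_smul_sub_mem hx (mem_closedBall_zero_iff.2 (hnorm x hx).le)
      ⟨(ht i).1.le, ht1 i⟩
  have hvol : ∀ i, ∫ x in B, (1 + t i • D x).det ∂μ = μ.real B := fun i => by
    have h1 := integral_image_eq_integral_abs_det_fderiv_smul μ hBc.measurableSet
      (f := fun x => x + t i • (r x - x)) (f' := fun x => 1 + t i • D x)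
      (fun x hx => ((hasFDerivAt_id x).add ((hDd x hx).const_smul (t i))).hasFDerivWithinAt)
      (hbij i).injOn (fun _ => (1 : ℝ))
    rw [(hbij i).image_eq, setIntegral_const, smul_eq_mul, mul_one] at h1
    rw [h1]
    refine setIntegral_congr_fun hBc.measurableSet fun x hx => ?_
    have hpos : 0 < (1 + t i • D x).det := by
      refine ContinuousLinearMap.det_one_add_pos ?_
      rw [norm_smul, Real.norm_of_nonneg (ht i).1.le]
      exact (mul_le_mul_of_nonneg_left (hK x hx) (ht i).1.le).trans_lt (htK i)
    simp [abs_of_pos hpos]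
  have hint : ∀ i, IntegrableOn (fun x => (1 + t i • D x).det) B μ := fun i => by
    refine ContinuousOn.integrableOn_compact hBc ?_
    exact ContinuousLinearMap.continuous_det.comp_continuousOn
      (continuousOn_const.add (hDc.const_smul (t i)))
  have hsum : ∫ x in B, (1 + D x).det ∂μ = μ.real B := by
    -- The interpolation identity at `A = 0`.
    have h1 : (1 : ℝ) = ∑ i ∈ Finset.range N, c i := by
      have h2 := hdet 0
      have h3 : (1 : E →L[ℝ] E).det = 1 := map_one (LinearMap.det (M := E) (A := ℝ))
      simpa [h3] using h2
    calc ∫ x in B, (1 + D x).det ∂μ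
        = ∫ x in B, ∑ i ∈ Finset.range N, c i * (1 + t i • D x).det ∂μ :=
          integral_congr_ae (Filter.Eventually.of_forall fun x => hdet (D x))
      _ = ∑ i ∈ Finset.range N, c i * μ.real B := by
          rw [integral_finsetSum _ fun i _ => (hint i).const_mul (c i)]
          simp only [integral_const_mul, hvol]
      _ = μ.real B := by rw [← Finset.sum_mul, ← h1, one_mul]
  have hzero : ∫ x in B, (1 + D x).det ∂μ = 0 := by
    refine setIntegral_eq_zero_of_forall_eq_zero fun x hx => ?_
    have hDx : 1 + D x = fderiv ℝ r x := add_sub_cancel _ _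
    rw [hDx]
    -- If `r'` were onto, some `v` would have `r' v = r x`; differentiating `‖r‖ ^ 2 = R ^ 2` along
    -- `v` gives `2 R ^ 2 = 0`.
    by_contra hne
    have hsurj : Function.Surjective (fderiv ℝ r x) := by
      have hu : IsUnit ((fderiv ℝ r x : E →L[ℝ] E) : E →ₗ[ℝ] E) :=
        (LinearMap.isUnit_iff_isUnit_det _).2 (isUnit_iff_ne_zero.2 hne)
      exact ((Module.End.isUnit_iff _).1 hu).2
    have huniq : UniqueDiffWithinAt ℝ B x := by
      refine uniqueDiffWithinAt_convex hBconv ⟨0, ?_⟩ (subset_closure hx)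
      exact mem_interior_iff_mem_nhds.2 (Metric.closedBall_mem_nhds 0 hR)
    have hd1 := ((hdiff x hx).norm_sq).hasFDerivWithinAt (s := B)
    have hd2 : HasFDerivWithinAt (fun y => ‖r y‖ ^ 2) (0 : E →L[ℝ] ℝ) B x :=
      (hasFDerivWithinAt_const (R ^ 2) x B).congr (fun y hy => by rw [hnorm y hy])
        (by rw [hnorm x hx])
    have heq := huniq.eq hd1 hd2
    obtain ⟨v, hv⟩ := hsurj (r x)
    have h1 := congrArg (fun φ : E →L[ℝ] ℝ => φ v) heq
    simp [hv, hnorm x hx, hR.ne'] at h1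
  have hpos : 0 < μ.real B :=
    ENNReal.toReal_pos (Metric.measure_closedBall_pos μ 0 hR).ne' hBc.measure_lt_top.ne
  linarith

end NoRetraction

/-! ### Brouwer's fixed point theorem -/

section Brouwer

variable {E : Type*} [NormedAddCommGroup E] [InnerProductSpace ℝ E] [FiniteDimensional ℝ E]

/-- Brouwer's fixed point theorem for `C¹` self-maps of a closed ball. -/
theorem exists_fixedPoint_closedBall_of_contDiff {R : ℝ} (hR : 0 < R) {g : E → E}
    (hg : ContDiff ℝ 1 g)
    (hmaps : Set.MapsTo g (Metric.closedBall 0 R) (Metric.closedBall 0 R)) :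
    ∃ x ∈ Metric.closedBall (0 : E) R, g x = x := by
  by_contra! hfix
  let d : E → E := fun x => x - g x
  have hd : ContDiff ℝ 1 d := contDiff_id.sub hg
  let b : E → ℝ := fun x => inner ℝ x (d x)
  have hb : ContDiff ℝ 1 b := contDiff_id.inner ℝ hd
  let disc : E → ℝ := fun x => b x ^ 2 + ‖d x‖ ^ 2 * (R ^ 2 - ‖x‖ ^ 2)
  have hdisc : ContDiff ℝ 1 disc :=
    (hb.pow 2).add ((hd.norm_sq ℝ).mul (contDiff_const.sub (contDiff_id.norm_sq ℝ)))
  -- The larger root of `‖x + s d‖ ^ 2 = R ^ 2`: the ray from `g x` through `x` leaves the ball at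
  -- `x + s d`.
  let s : E → ℝ := fun x => (-b x + √(disc x)) / ‖d x‖ ^ 2
  have hd0 : ∀ x ∈ Metric.closedBall (0 : E) R, 0 < ‖d x‖ ^ 2 := fun x hx =>
    pow_pos (norm_pos_iff.2 (sub_ne_zero.2 (hfix x hx).symm)) 2
  have hbpos : ∀ x, ‖x‖ = R → 0 < b x := fun x hx => by
    have hxB : x ∈ Metric.closedBall (0 : E) R := mem_closedBall_zero_iff.2 hx.le
    have h1 := hd0 x hxB
    have h2 : ‖d x‖ ^ 2 = R ^ 2 - 2 * inner ℝ x (g x) + ‖g x‖ ^ 2 := by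
      rw [← hx]; exact norm_sub_sq_real x (g x)
    have h3 : b x = R ^ 2 - inner ℝ x (g x) := by
      change inner ℝ x (x - g x) = _
      rw [inner_sub_right, real_inner_self_eq_norm_sq, hx]
    have h4 := mem_closedBall_zero_iff.1 (hmaps hxB)
    -- Here `2 b = ‖d‖ ^ 2 + R ^ 2 - ‖g x‖ ^ 2`.
    nlinarith [norm_nonneg (g x)]
  have hdpos : ∀ x ∈ Metric.closedBall (0 : E) R, 0 < disc x := fun x hx => by
    rcases (mem_closedBall_zero_iff.1 hx).lt_or_eq with hlt | heq
    · have h1 : 0 < R ^ 2 - ‖x‖ ^ 2 := by nlinarith [norm_nonneg x]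
      have h2 := mul_pos (hd0 x hx) h1
      have h3 := sq_nonneg (b x)
      change 0 < b x ^ 2 + ‖d x‖ ^ 2 * (R ^ 2 - ‖x‖ ^ 2)
      linarith
    · change 0 < b x ^ 2 + ‖d x‖ ^ 2 * (R ^ 2 - ‖x‖ ^ 2)
      rw [heq, sub_self, mul_zero, add_zero]
      exact pow_pos (hbpos x heq) 2
  refine not_exists_contDiffAt_retraction hR (r := fun x => x + s x • d x)
    (fun x hx => ?_) (fun x hx => ?_) (fun x hx => ?_)
  · have hs : ContDiffAt ℝ 1 s x :=
      (hb.contDiffAt.neg.add (hdisc.contDiffAt.sqrt (hdpos x hx).ne')).div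
        (hd.norm_sq ℝ).contDiffAt (hd0 x hx).ne'
    exact contDiffAt_id.add (hs.smul hd.contDiffAt)
  · have ha := hd0 x hx
    have hq := Real.sq_sqrt (hdpos x hx).le
    have hsa : s x * ‖d x‖ ^ 2 = -b x + √(disc x) := div_mul_cancel₀ _ ha.ne'
    have hn : ‖x + s x • d x‖ ^ 2 = ‖x‖ ^ 2 + 2 * (s x * b x) + s x ^ 2 * ‖d x‖ ^ 2 := by
      rw [norm_add_sq_real, inner_smul_right, norm_smul, mul_pow, Real.norm_eq_abs, sq_abs]
    have hd' : disc x = b x ^ 2 + ‖d x‖ ^ 2 * (R ^ 2 - ‖x‖ ^ 2) := rfl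
    have h1 : ‖d x‖ ^ 2 * ‖x + s x • d x‖ ^ 2 = ‖d x‖ ^ 2 * R ^ 2 := by
      rw [hn]
      linear_combination (2 * b x + s x * ‖d x‖ ^ 2 + (-b x + √(disc x))) * hsa + hq + hd'
    have h2 := mul_left_cancel₀ ha.ne' h1
    exact (pow_left_inj₀ (norm_nonneg _) hR.le two_ne_zero).1 h2
  · have h1 : disc x = b x ^ 2 := by
      change b x ^ 2 + ‖d x‖ ^ 2 * (R ^ 2 - ‖x‖ ^ 2) = _
      rw [hx, sub_self, mul_zero, add_zero]
    have h2 : s x = 0 := by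
      change (-b x + √(disc x)) / ‖d x‖ ^ 2 = 0
      rw [h1, Real.sqrt_sq (hbpos x hx).le, neg_add_cancel, zero_div]
    change x + s x • d x = x
    rw [h2, zero_smul, add_zero]

/-- Brouwer's fixed point theorem for a continuous map into a closed ball. -/
theorem Continuous.exists_fixedPoint_of_mem_closedBall {R : ℝ} (hR : 0 < R) {F : E → E}
    (hF : Continuous F) (hmaps : ∀ x, F x ∈ Metric.closedBall (0 : E) R) :
    ∃ x, F x = x := by
  by_contra! hfix
  have hcont : ContinuousOn (fun x => ‖F x - x‖) (Metric.closedBall 0 R) := by fun_prop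
  obtain ⟨x₀, -, hmin⟩ := (isCompact_closedBall (0 : E) R).exists_isMinOn
    ⟨0, Metric.mem_closedBall_self hR.le⟩ hcont
  have hδ : 0 < ‖F x₀ - x₀‖ := norm_pos_iff.2 (sub_ne_zero.2 (hfix x₀))
  -- A smooth `g` closer to `F` than the least displacement of `F` on the ball; a fixed point of `g`
  -- would be displaced by less than that minimum.
  obtain ⟨g, hg⟩ := exists_contMDiffMap_forall_mem_convex_of_local_const (n := 1)
    (modelWithCornersSelf ℝ E)
    (t := fun x => Metric.closedBall (0 : E) R ∩ Metric.ball (F x) ‖F x₀ - x₀‖)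
    (fun x => (convex_closedBall _ _).inter (convex_ball _ _))
    (fun x => ⟨F x, by
      filter_upwards [hF.continuousAt (Metric.ball_mem_nhds (F x) hδ)] with y hy
      exact ⟨hmaps x, Metric.mem_ball'.2 hy⟩⟩)
  obtain ⟨x, hx, hgx⟩ := exists_fixedPoint_closedBall_of_contDiff hR
    (g := g) (contMDiff_iff_contDiff.1 g.contMDiff) fun x _ => (hg x).1
  have h1 := (hg x).2
  rw [hgx, Metric.mem_ball', dist_eq_norm] at h1
  exact absurd (hmin hx) (not_le.2 h1)

/-- Brouwer's fixed point theorem for a nonempty compact convex set. -/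
theorem IsCompact.exists_fixedPoint_of_convex {K : Set E} (hK : IsCompact K) (hconv : Convex ℝ K)
    (hne : K.Nonempty) {F : K → K} (hF : Continuous F) : ∃ x, F x = x := by
  obtain ⟨P, hPl, hP⟩ := hconv.exists_projection hne hK.isComplete
  obtain ⟨R, hR, hKR⟩ := hK.isBounded.subset_closedBall_lt 0 0
  let G : E → E := fun x => F ⟨P x, (hP x).1⟩
  have hG : Continuous G :=
    continuous_subtype_val.comp (hF.comp (hPl.continuous.subtype_mk fun x => (hP x).1))
  obtain ⟨x, hx⟩ := hG.exists_fixedPoint_of_mem_closedBall hR fun x => hKR (Subtype.coe_prop _)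
  have hxK : x ∈ K := hx ▸ (F ⟨P x, (hP x).1⟩).2
  have hPx : P x = x := by
    have h1 := (hP x).2 x hxK
    rw [real_inner_self_eq_norm_sq] at h1
    have h2 : ‖x - P x‖ = 0 := by nlinarith [norm_nonneg (x - P x)]
    exact (sub_eq_zero.1 (norm_eq_zero.1 h2)).symm
  refine ⟨⟨x, hxK⟩, Subtype.ext ?_⟩
  have h2 : (⟨P x, (hP x).1⟩ : K) = ⟨x, hxK⟩ := Subtype.ext hPx
  rw [← h2]
  exact hx.trans hPx.symm

end Brouwer

/-! ### Continuity of minimizers and maxima of strictly convex functions -/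

/-- On a compact space, a selection of minimizers of a jointly continuous function is continuous as
soon as the minimizers are unique. -/
theorem continuous_argmin_of_unique {X Y : Type*} [TopologicalSpace X] [TopologicalSpace Y]
    [CompactSpace Y] {g : X → Y → ℝ} (hg : Continuous (Function.uncurry g)) {A : X → Y}
    (hA : ∀ x y, g x (A x) ≤ g x y) (huniq : ∀ x y, g x y ≤ g x (A x) → y = A x) :
    Continuous A := by
  have hclosed : IsClosed {z : X × Y | z.2 = A z.1} := by
    have : {z : X × Y | z.2 = A z.1} = ⋂ y, {z : X × Y | g z.1 z.2 ≤ g z.1 y} := by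
      ext z
      simp only [Set.mem_ofPred_eq, Set.mem_iInter]
      exact ⟨fun h y => h ▸ hA z.1 y, fun h => huniq _ _ (h _)⟩
    rw [this]
    refine isClosed_iInter fun y => isClosed_le hg ?_
    exact hg.comp (continuous_fst.prodMk continuous_const)
  refine continuous_iff_isClosed.2 fun C hC => ?_
  -- Projection along the compact factor is a closed map, so a closed graph suffices.
  have : A ⁻¹' C = Prod.fst '' ({z : X × Y | z.2 = A z.1} ∩ Prod.snd ⁻¹' C) := by
    ext x
    constructor
    · exact fun hx => ⟨(x, A x), ⟨rfl, hx⟩, rfl⟩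
    · rintro ⟨z, ⟨hz, hzC⟩, rfl⟩
      have hz' : z.2 = A z.1 := hz
      rw [Set.mem_preimage, ← hz']
      exact hzC
  rw [this]
  exact isClosedMap_fst_of_compactSpace _ (hclosed.inter (hC.preimage continuous_snd))

/-- The pointwise maximum of strictly convex functions is strictly convex, provided that each
maximum is attained. -/
theorem strictConvexOn_sSup_image {ι E : Type*} [AddCommGroup E] [Module ℝ E] {U : Set E}
    {C : Set ι} {L : ι → E → ℝ} (hU : Convex ℝ U) (hL : ∀ w ∈ C, StrictConvexOn ℝ U (L w))
    (hmax : ∀ v ∈ U, ∃ w ∈ C, IsMaxOn (fun w' => L w' v) C w) :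
    StrictConvexOn ℝ U (fun v => sSup ((fun w => L w v) '' C)) := by
  have hle : ∀ v ∈ U, ∀ w ∈ C, L w v ≤ sSup ((fun w => L w v) '' C) := fun v hv w hw => by
    obtain ⟨w₀, -, hw₀⟩ := hmax v hv
    exact le_csSup ⟨L w₀ v, by rintro _ ⟨w', hw', rfl⟩; exact hw₀ hw'⟩ ⟨w, hw, rfl⟩
  refine ⟨hU, fun x hx y hy hxy a b ha hb hab => ?_⟩
  -- A single maximizer at the convex combination keeps the inequality strict, which a mere supremum
  -- could lose.
  obtain ⟨w, hw, hwmax⟩ := hmax _ (hU hx hy ha.le hb.le hab)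
  calc sSup ((fun w' => L w' (a • x + b • y)) '' C) ≤ L w (a • x + b • y) :=
        csSup_le ⟨_, w, hw, rfl⟩ (by rintro _ ⟨w', hw', rfl⟩; exact hwmax hw')
    _ < a • L w x + b • L w y := (hL w hw).2 hx hy hxy ha hb hab
    _ ≤ _ := add_le_add (smul_le_smul_of_nonneg_left (hle x hx w hw) ha.le)
        (smul_le_smul_of_nonneg_left (hle y hy w hw) hb.le)

/-! ### Existence of a stable control -/

theorem mainTheorem1 {n m T : ℕ} (S : NoisySystem n m T) (p : ℝ) (hp0 : 0 < p) (hp1 : p < 1)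
    (ε : Fin T → ℝ≥0)
    (hne : S.controls.Nonempty)
    (hcompact : IsCompact S.controls)
    (hconvex : Convex ℝ S.controls)
    -- the maximum that defines `g(u, v)` exists
    (hmax : ∀ u ∈ S.controls, ∀ v ∈ S.controls,
      ∃ w ∈ S.confidenceSet p u, IsMaxOn (fun w' => S.loss w' v) (S.confidenceSet p u) w)
    (hstrict : ∀ w : Traj n T, StrictConvexOn ℝ S.controls (fun u => S.loss w u))
    (hcont : ContinuousOn (fun z : Traj m T × Traj m T => S.worstCaseLoss p z.1 z.2)
      (S.controls ×ˢ S.controls))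
    (hlip : ∀ t : Fin T, LipschitzOnWith (ε t) (S.quantile p t) S.controls) :
    (∃ A : S.controls → S.controls, S.IsIdealRefinement p A) ∧
      ∀ A : S.controls → S.controls, S.IsIdealRefinement p A →
        ∃ u : S.controls, S.IsPerformativelyStable A u := by
  have hconvg : ∀ u ∈ S.controls,
      StrictConvexOn ℝ S.controls (fun v => S.worstCaseLoss p u v) := fun u hu =>
    strictConvexOn_sSup_image hconvex (fun w _ => hstrict w) (hmax u hu)
  constructor
  · have hex : ∀ u : S.controls, ∃ v : S.controls,
        IsMinOn (fun v => S.worstCaseLoss p u v) S.controls v := fun u => by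
      obtain ⟨v, hv, hmin⟩ := hcompact.exists_isMinOn hne
        (f := fun v => S.worstCaseLoss p u v)
        (hcont.comp (f := fun v => ((u : Traj m T), v)) (by fun_prop) fun v hv => ⟨u.2, hv⟩)
      exact ⟨⟨v, hv⟩, hmin⟩
    choose A hA using hex
    exact ⟨A, hA⟩
  · intro A hA
    have : CompactSpace S.controls := isCompact_iff_compactSpace.1 hcompact
    refine hcompact.exists_fixedPoint_of_convex hconvex hne (F := A)
      (continuous_argmin_of_unique
        (g := fun u v : S.controls => S.worstCaseLoss p u v) ?_
        (fun u v => hA u v.2) fun u v hv => Subtype.ext ?_)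
    · exact hcont.comp_continuous (f := fun z : S.controls × S.controls =>
        ((z.1 : Traj m T), (z.2 : Traj m T))) (by fun_prop) fun z => ⟨z.1.2, z.2.2⟩
    · exact (hconvg u u.2).eq_of_isMinOn (fun v' hv' => hv.trans (hA u hv')) (hA u) v.2 (A u).2
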